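/- **Notation.** For $n\ge 1$ write a permutation $\pi\in\mathfrak S_n$ of $[n]=\{1,\dots,n\}$ as the word $\pi(1)\cdots\pi(n)$. A descent of a word $w=w(1)\cdots w(n)$ is an index $i\in[n-1]$ with $w(i)>w(i+1)$; a double descent is an $i\in[n-2]$ with $w(i)>w(i+1)>w(i+2)$; an interior peak is an $i\in\{2,\dots,n-1\}$ with $w(i-1)<w(i)>w(i+1)$. A permutation $\pi\in\mathfrak S_n$ is simsun if for every $k\in[n]$ the subword of $\pi$ formed by the letters $1,\dots,k$ has no double descent. Let $\mathcal{RS}_{n,k}$ be the set of simsun permutations of $[n]$ with exactly $k$ descents, $\mathfrak S_{n,k}$ the set of permutations of $[n]$ with exactly $k$ interior peaks, $S(n,k)=\#\mathcal{RS}_{n,k}$, $W(n,k)=\#\mathfrak S_{n,k}$, and $S_n(x)=\sum_{k=0}^{\lfloor n/2\rfloor}S(n,k)x^k$. **The correspondence $\Phi$.** In a word $w$ of length $n$, "position $j$" ($0\le j\le n$) is the place right after $w(j)$ (the front if $j=0$). For $\pi\in\mathcal{RS}_{n,k}$ with descent set $D$, label the positions in $D$, in increasing order, by $x_1,\dots,x_k$,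 and the positions in $\{0,\dots,n-1\}\setminus(D\cup(D-1))$, in increasing order, by $y_1,\dots,y_{n-2k}$. For $\sigma\in\mathfrak S_{n+1,k}$ with interior peaks $i_1<\dots<i_k$, label both positions $i_r-1$ and $i_r$ by $p_r$, and label the positions in $\{1,\dots,n\}$ different from all $i_r$ and $i_r-1$, in increasing order, by $q_1,\dots,q_{n-2k}$. The sets $\Phi(\pi)\subseteq\mathfrak S_{n+1}$, for simsun $\pi\in\mathfrak S_n$, are defined recursively: $\Phi(1)=\{12,21\}$, and if $\widehat\pi\in\mathfrak S_{m+1}$ is obtained by inserting $m+1$ into the simsun permutation $\pi\in\mathfrak S_m$, then $\Phi(\widehat\pi)$ consists of all permutations obtained from the $\sigma\in\Phi(\pi)$ by inserting $m+2$ * at the front or at the end of $\sigma$, if $m+1$ was inserted at the end of $\pi$; * at one of the two positions of $\sigma$ labelled $p_r$, if $m+1$ was inserted at the position of $\pi$ labelled $x_r$; * at the position of $\sigma$ labelled $q_s$, if $m+1$ was inserted at the position of $\pi$ labelled $y_s$. **Proposition.** Let $n\ge 1$. 1. For $0\le k\le\lfloor n/2\rfloor$, $$W(n+1,k)=2^{n-k}S(n,k).$$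 2. For all complex $x\neq 0$, $$S_n(x)=\frac{1}{2^{n+1}x}\sum_{k=0}^{\lfloor n/2\rfloor+1}p(n+1,n-2k+2)\,(2x-1)^k,$$ where $$p(n,n-2k+1)=(-1)^k\sum_{i=1}^{n} i!\,{n\brace i}\,(-2)^{n-i}\left[\binom{i}{n-2k}-\binom{i}{n-2k+1}\right],$$ ${n\brace i}$ are the Stirling numbers of the second kind, and $\binom{i}{j}=0$ for $j<0$. 3. $\Phi$ realizes identity 1 as a $1$-to-$2^{n-k}$ correspondence: for $0\le k\le\lfloor n/2\rfloor$ and every $\pi\in\mathcal{RS}_{n,k}$, $\Phi(\pi)$ is a subset of $\mathfrak S_{n+1,k}$ with exactly $2^{n-k}$ elements, and every $\sigma\in\mathfrak S_{n+1,k}$ belongs to $\Phi(\pi)$ for exactly one $\pi\in\mathcal{RS}_{n,k}$. -/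

import Mathlib

namespace Simsun

/-! Words in the positive integers are lists; positions in a word are numbered from `1`. -/

/-- `entry w i` is the `i`-th letter `w(i)` of the word `w`, for `1 ≤ i ≤ w.length`. -/
def entry (w : List ℕ) (i : ℕ) : ℕ := w.getD (i - 1) 0

/-- The set of descents of `w`: indices `1 ≤ i ≤ n - 1` with `w(i) > w(i+1)`, `n` the length. -/
def descents (w : List ℕ) : Finset ℕ :=
  (Finset.Icc 1 (w.length - 1)).filter fun i => entry w i > entry w (i + 1)

/-- The number of descents. -/
def des (w : List ℕ) : ℕ := (descents w).card

/-- The set of interior peaks of `w`: indices `2 ≤ i ≤ n - 1` with `w(i-1) < w(i) > w(i+1)`. -/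
def peaks (w : List ℕ) : Finset ℕ :=
  (Finset.Icc 2 (w.length - 1)).filter fun i =>
    entry w (i - 1) < entry w i ∧ entry w i > entry w (i + 1)

/-- The number of interior peaks. -/
def pk (w : List ℕ) : ℕ := (peaks w).card

/-- `w` has a double descent: an index `1 ≤ i ≤ n - 2` with `w(i) > w(i+1) > w(i+2)`. -/
def HasDoubleDescent (w : List ℕ) : Prop :=
  ∃ i ∈ Finset.Icc 1 (w.length - 2),
    entry w i > entry w (i + 1) ∧ entry w (i + 1) > entry w (i + 2)

/-- `w` is simsun: for all `k`, the subword of letters in `{1, …, k}` has no double descents.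
For `k` beyond the length of a permutation word nothing new happens. -/
def IsSimsun (w : List ℕ) : Prop :=
  ∀ k ∈ Finset.Icc 1 w.length, ¬ HasDoubleDescent (w.filter fun a => a ≤ k)

instance (w : List ℕ) : Decidable (HasDoubleDescent w) := by
  unfold HasDoubleDescent; infer_instance

instance (w : List ℕ) : Decidable (IsSimsun w) := by
  unfold IsSimsun; infer_instance

/-- The one-line word `π(1) π(2) … π(n)` of a permutation of `[n]`; the elements `1, …, n`
of `[n]` are represented by the elements `0, …, n - 1` of `Fin n`. -/
def word {n : ℕ} (π : Equiv.Perm (Fin n)) : List ℕ := List.ofFn fun i => (π i : ℕ) + 1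

/-- The simsun permutations of `[n]` with exactly `k` descents. -/
def simsunPerms (n k : ℕ) : Finset (Equiv.Perm (Fin n)) :=
  Finset.univ.filter fun π => IsSimsun (word π) ∧ des (word π) = k

/-- The permutations of `[n]` with exactly `k` interior peaks. -/
def peakPerms (n k : ℕ) : Finset (Equiv.Perm (Fin n)) :=
  Finset.univ.filter fun π => pk (word π) = k

/-- The number `S(n,k)` of simsun permutations of `[n]` with `k` descents. -/
def S (n k : ℕ) : ℕ := (simsunPerms n k).card

/-- The number `W(n,k)` of permutations of `[n]` with `k` interior peaks. -/
def W (n k : ℕ) : ℕ := (peakPerms n k).card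

/-- The polynomial `S_n(x) = ∑_{k=0}^{⌊n/2⌋} S(n,k) x^k`. -/
noncomputable def SPoly (n : ℕ) : Polynomial ℤ :=
  ∑ k ∈ Finset.range (n / 2 + 1), Polynomial.C (S n k : ℤ) * Polynomial.X ^ k

/-- The binomial coefficient with integer lower index, zero when that index is negative. -/
def binom (i : ℕ) (j : ℤ) : ℤ := if 0 ≤ j then (i.choose j.toNat : ℤ) else 0

/-- The number usually written `p(n, n - 2k + 1)`, as a function of `n` and `k`. The terms
with `i > n` vanish because the Stirling number `{n \brace i}` does. -/
def p (n k : ℕ) : ℤ :=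
  (-1) ^ k * ∑ i ∈ Finset.Icc 1 n,
    (i.factorial : ℤ) * (Nat.stirlingSecond n i : ℤ) * (-2) ^ (n - i) *
      (binom i ((n : ℤ) - 2 * k) - binom i ((n : ℤ) - 2 * k + 1))

/-! ### The correspondence between simsun permutations and permutations by interior peaks -/

/-- `i` is the `r`-th smallest element of `A` (counting from `r = 1`). -/
def IsNth (A : Finset ℕ) (r i : ℕ) : Prop := i ∈ A ∧ (A.filter fun j => j ≤ i).card = r

/-- The positions carrying a `y`-label in a word of length `n`: the elements of
`{0, …, n - 1}` which are neither a descent `i` nor of the form `i - 1` for a descent `i`.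
(The `x`-labels stand at the descents.) A label at `j` stands right after the `j`-th letter,
at the front of the word if `j = 0`. -/
def yPositions (w : List ℕ) : Finset ℕ :=
  Finset.range w.length \ (descents w ∪ (descents w).image fun i => i - 1)

/-- The positions carrying a `q`-label in a word of length `n`: the elements of
`{1, …, n - 1}` which are neither an interior peak `i` nor of the form `i - 1` for an interior
peak `i`. (The two labels `p_r` stand right before and right after the `r`-th interior peak.) -/
def qPositions (w : List ℕ) : Finset ℕ :=
  Finset.Icc 1 (w.length - 1) \ (peaks w ∪ (peaks w).image fun i => i - 1)

/-- `PhiRel m w v`: the word `v` (of a permutation of `[m + 1]`) corresponds to the word `w`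
(of a simsun permutation of `[m]`). Note that `w.insertIdx j a` inserts the letter `a` right
after the `j`-th letter of `w` (at the front for `j = 0`). -/
inductive PhiRel : ℕ → List ℕ → List ℕ → Prop
  | one_left : PhiRel 1 [1] [1, 2]
  | one_right : PhiRel 1 [1] [2, 1]
  /-- `m + 1` is appended to `w`; `m + 2` is put at the front of `v`. -/
  | front {m : ℕ} {w v : List ℕ} (h : PhiRel m w v) :
      PhiRel (m + 1) (w ++ [m + 1]) ((m + 2) :: v)
  /-- `m + 1` is appended to `w`; `m + 2` is appended to `v`. -/
  | back {m : ℕ} {w v : List ℕ} (h : PhiRel m w v) :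
      PhiRel (m + 1) (w ++ [m + 1]) (v ++ [m + 2])
  /-- `m + 1` is put at the label `x_r` of `w`; `m + 2` right before the `r`-th peak of `v`. -/
  | x_before {m : ℕ} {w v : List ℕ} (h : PhiRel m w v) {r i j : ℕ}
      (hi : IsNth (descents w) r i) (hj : IsNth (peaks v) r j) :
      PhiRel (m + 1) (w.insertIdx i (m + 1)) (v.insertIdx (j - 1) (m + 2))
  /-- `m + 1` is put at the label `x_r` of `w`; `m + 2` right after the `r`-th peak of `v`. -/
  | x_after {m : ℕ} {w v : List ℕ} (h : PhiRel m w v) {r i j : ℕ}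
      (hi : IsNth (descents w) r i) (hj : IsNth (peaks v) r j) :
      PhiRel (m + 1) (w.insertIdx i (m + 1)) (v.insertIdx j (m + 2))
  /-- `m + 1` is put at the label `y_s` of `w`; `m + 2` at the label `q_s` of `v`. -/
  | y {m : ℕ} {w v : List ℕ} (h : PhiRel m w v) {s i j : ℕ}
      (hi : IsNth (yPositions w) s i) (hj : IsNth (qPositions v) s j) :
      PhiRel (m + 1) (w.insertIdx i (m + 1)) (v.insertIdx j (m + 2))

/-- `Phi π`: the set of permutations of `[n + 1]` corresponding to `π`. -/
def Phi {n : ℕ} (π : Equiv.Perm (Fin n)) : Set (Equiv.Perm (Fin (n + 1))) :=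
  {σ | PhiRel n (word π) (word σ)}

end Simsun

namespace Simsun

/-! ### Inserting a letter into a word -/

/-! Everything rests on deleting and reinserting the largest letter. A new maximum inserted at
position `j` creates a descent unless `j` is the end, and destroys a descent at `j`; it creates an
interior peak unless `j` is one of the two ends, and destroys a peak at `j` or `j + 1`.

Hence a simsun word of length m with k descents has k + 1 admissible positions that keep the number
of descents (the end and the k descents) and m - 2k that raise it by one. A permutation of [m + 1]
with k peaks has 2(k + 1) positions that keep the number of peaks (both ends and both sides of each
peak) and m - 2k that raise it by one. The labels match the former two to one and the latter one to
one. By induction, corresponding words satisfy `des w = pk v`, each `v` has exactly one partner `w`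
(`existsUnique_phiRel`), and each simsun `w` has 2^(m - k) partners (`card_filter_phiRel`): a
keeping insertion doubles this number and increases m - k by one, a raising insertion changes
neither. Thus the sets `Phi π` partition the permutations by peaks, which gives identity 1.

For the closed formula, the same count of positions gives a recursion for S(n,k), hence the
differential recursion `SPoly_succ`. On the other side let F_n(z) be the sum of i! {n brace i}
(-2)^(n-i) (1+z)^i. The Stirling recursion becomes F_{n+1} = (1+z) F_n + (z^2-1) F_n', so G_n =
(z-1) F_n satisfies G_{n+1} = (z^2-1) G_n'. The numbers p are, up to sign, coefficients of G_n,
which yields `pPoly_succ`. The substitution y = 2x - 1 turns that recursion into the one for 2^(n+1)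
x S_n(x). -/

theorem erase_insertIdx {α : Type*} [DecidableEq α] {a : α} :
    ∀ {w : List α} {j : ℕ}, j ≤ w.length → a ∉ w → (w.insertIdx j a).erase a = w
  | _, 0, _, _ => by simp
  | [], j + 1, h, _ => by simp at h
  | b :: w, j + 1, h, ha => by
    have hb : b ≠ a := fun e => ha (by simp [e])
    have := erase_insertIdx (w := w) (j := j) (by simpa using h) (fun h' => ha (List.mem_cons_of_mem _ h'))
    simp [List.insertIdx_succ_cons, List.erase_cons_tail, hb, this]

theorem filter_insertIdx {α : Type*} {a : α} {P : α → Bool} (ha : P a = false) :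
    ∀ (w : List α) (j : ℕ), (w.insertIdx j a).filter P = w.filter P
  | _, 0 => by simp [ha]
  | [], j + 1 => by simp
  | b :: w, j + 1 => by
    simp [List.insertIdx_succ_cons, List.filter_cons, filter_insertIdx ha w j]

theorem exists_insertIdx_of_mem {α : Type*} [DecidableEq α] {a : α} {w : List α} (h : a ∈ w) :
    ∃ j ≤ (w.erase a).length, w = (w.erase a).insertIdx j a := by
  have hlt := List.idxOf_lt_length_of_mem h
  refine ⟨w.idxOf a, ?_, ?_⟩
  · rw [List.length_erase_of_mem h]; omega
  · rw [List.erase_eq_eraseIdx_of_idxOf rfl]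
    conv_lhs => rw [← List.insertIdx_eraseIdx_getElem hlt]
    simp

theorem insertIdx_inj {α : Type*} [DecidableEq α] {a : α} {w w' : List α} {j j' : ℕ}
    (hj : j ≤ w.length) (hj' : j' ≤ w'.length) (ha : a ∉ w) (ha' : a ∉ w')
    (h : w.insertIdx j a = w'.insertIdx j' a) : w = w' ∧ j = j' := by
  have hw : w = w' := by rw [← erase_insertIdx hj ha, h, erase_insertIdx hj' ha']
  subst hw
  exact ⟨rfl, List.injOn_insertIdx_index_of_notMem w a ha hj hj' h⟩

/-- By truncated subtraction `entry` at 0 reads the first letter, which an insertion at the front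
changes; hence `1 ≤ i`. -/
theorem entry_insertIdx_of_le {w : List ℕ} {j a i : ℕ} (h1 : 1 ≤ i) (hi : i ≤ j) :
    entry (w.insertIdx j a) i = entry w i := by
  unfold entry
  rw [List.getD_eq_getElem?_getD, List.getD_eq_getElem?_getD, List.getElem?_insertIdx,
    if_pos (by omega)]

theorem entry_insertIdx_self {w : List ℕ} {j a : ℕ} (hj : j ≤ w.length) :
    entry (w.insertIdx j a) (j + 1) = a := by
  simp [entry, List.getElem?_insertIdx, hj]

theorem entry_insertIdx_of_gt {w : List ℕ} {j a i : ℕ} (hi : j + 1 < i) :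
    entry (w.insertIdx j a) i = entry w (i - 1) := by
  unfold entry
  rw [List.getD_eq_getElem?_getD, List.getD_eq_getElem?_getD, List.getElem?_insertIdx,
    if_neg (by omega), if_neg (by omega)]

/-- Outside the word `entry` returns 0, which is why `0 < a` is needed. -/
theorem entry_lt {w : List ℕ} {a : ℕ} (ha0 : 0 < a) (ha : ∀ b ∈ w, b < a) (i : ℕ) :
    entry w i < a := by
  unfold entry
  rw [List.getD_eq_getElem?_getD]
  by_cases h : i - 1 < w.length
  · rw [List.getElem?_eq_getElem h]
    exact ha _ (List.getElem_mem h)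
  · rw [List.getElem?_eq_none (by omega)]
    simpa using ha0

/-! ### Descents and peaks after the insertion of a largest letter -/

theorem mem_descents {w : List ℕ} {i : ℕ} :
    i ∈ descents w ↔ (1 ≤ i ∧ i < w.length) ∧ entry w (i + 1) < entry w i := by
  simp only [descents, Finset.mem_filter, Finset.mem_Icc]
  constructor <;> rintro ⟨⟨_, _⟩, _⟩ <;> refine ⟨⟨?_, ?_⟩, ?_⟩ <;> omega

theorem mem_peaks {w : List ℕ} {i : ℕ} :
    i ∈ peaks w ↔ (2 ≤ i ∧ i < w.length) ∧
      entry w (i - 1) < entry w i ∧ entry w (i + 1) < entry w i := by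
  simp only [peaks, Finset.mem_filter, Finset.mem_Icc]
  constructor <;> rintro ⟨⟨_, _⟩, _, _⟩ <;> refine ⟨⟨?_, ?_⟩, ?_, ?_⟩ <;> omega

theorem succ_notMem_peaks {w : List ℕ} {i : ℕ} (hi : i ∈ peaks w) : i + 1 ∉ peaks w := by
  intro h
  have h1 := (mem_peaks.1 hi).2.2
  have h2 := (mem_peaks.1 h).2.1
  rw [Nat.add_sub_cancel] at h2
  omega

theorem hasDoubleDescent_iff {w : List ℕ} :
    HasDoubleDescent w ↔ ∃ i, i ∈ descents w ∧ i + 1 ∈ descents w := by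
  simp only [HasDoubleDescent, mem_descents, Finset.mem_Icc]
  constructor
  · rintro ⟨i, ⟨h1, h2⟩, h3, h4⟩
    exact ⟨i, ⟨⟨h1, by omega⟩, h3⟩, ⟨by omega, by omega⟩, h4⟩
  · rintro ⟨i, ⟨⟨h1, h2⟩, h3⟩, ⟨h5, h6⟩, h4⟩
    exact ⟨i, ⟨h1, by omega⟩, h3, h4⟩

/-- The new letter exceeds both neighbours: the index `j` becomes an ascent, `j + 1` a descent if a
letter follows, and later descents move up by one. -/
theorem mem_descents_insertIdx {w : List ℕ} {a j : ℕ} (ha0 : 0 < a) (ha : ∀ b ∈ w, b < a)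
    (hj : j ≤ w.length) (i : ℕ) :
    i ∈ descents (w.insertIdx j a) ↔
      (i < j ∧ i ∈ descents w) ∨ (i = j + 1 ∧ j < w.length) ∨ (j + 1 < i ∧ i - 1 ∈ descents w) := by
  have hlt := entry_lt ha0 ha
  have hself := entry_insertIdx_self (a := a) hj
  rw [mem_descents, mem_descents, mem_descents, List.length_insertIdx_of_le_length hj]
  rcases Nat.eq_zero_or_pos i with rfl | hi
  · omega
  rcases lt_trichotomy i j with h | rfl | h
  · rw [entry_insertIdx_of_le hi h.le, entry_insertIdx_of_le (by omega) (show i + 1 ≤ j from h)]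
    omega
  · rw [entry_insertIdx_of_le hi le_rfl, hself]
    have := hlt i
    omega
  · rcases Nat.lt_or_eq_of_le (Nat.succ_le_of_lt h) with h' | rfl
    · rw [entry_insertIdx_of_gt h', entry_insertIdx_of_gt (by omega), Nat.add_sub_cancel,
        Nat.sub_add_cancel hi]
      omega
    · rw [Nat.succ_eq_add_one, hself, entry_insertIdx_of_gt (by omega), Nat.add_sub_cancel]
      have := hlt (j + 1)
      omega

/-- A neighbour of the maximum is never a peak, so old peaks at `j` and `j + 1` disappear. -/
theorem mem_peaks_insertIdx {w : List ℕ} {a j : ℕ} (ha0 : 0 < a) (ha : ∀ b ∈ w, b < a)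
    (hj : j ≤ w.length) (i : ℕ) :
    i ∈ peaks (w.insertIdx j a) ↔
      (i < j ∧ i ∈ peaks w) ∨ (i = j + 1 ∧ 0 < j ∧ j < w.length) ∨
        (j + 1 + 1 < i ∧ i - 1 ∈ peaks w) := by
  have hlt := entry_lt ha0 ha
  have hself := entry_insertIdx_self (a := a) hj
  rw [mem_peaks, mem_peaks, mem_peaks, List.length_insertIdx_of_le_length hj]
  rcases Nat.lt_or_ge i 2 with hi | hi
  · omega
  rcases lt_trichotomy i j with h | rfl | h
  · rw [entry_insertIdx_of_le (by omega) h.le, entry_insertIdx_of_le (by omega) (show i + 1 ≤ j from h),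
      entry_insertIdx_of_le (by omega) (by omega)]
    omega
  · rw [entry_insertIdx_of_le (by omega) le_rfl, hself]
    have := hlt i
    omega
  · rcases Nat.lt_or_eq_of_le (Nat.succ_le_of_lt h) with h' | rfl
    · rcases Nat.lt_or_eq_of_le (Nat.succ_le_of_lt h') with h'' | rfl
      · rw [entry_insertIdx_of_gt h', entry_insertIdx_of_gt (by omega),
          entry_insertIdx_of_gt (by omega), Nat.add_sub_cancel, Nat.sub_add_cancel (by omega)]
        omega
      · simp only [Nat.succ_eq_add_one, Nat.add_sub_cancel]
        rw [hself, entry_insertIdx_of_gt (by omega)]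
        have := hlt (j + 1 + 1 - 1)
        omega
    · simp only [Nat.succ_eq_add_one, Nat.add_sub_cancel]
      rw [hself, entry_insertIdx_of_gt (i := j + 1 + 1) (by omega),
        entry_insertIdx_of_le (by omega) le_rfl]
      have h1 := hlt j
      have h2 := hlt (j + 1 + 1 - 1)
      simp only [true_and]
      omega

/-- Common bookkeeping for both statistics: elements below `j` stay, those in `[j, c]` are lost,
those above `c` shift by one. It is used with `c = j` for descents and `c = j + 1` for peaks. -/
theorem card_of_mem_iff_shift {A A' : Finset ℕ} {j c : ℕ} {P : Prop} [Decidable P] (hc : j ≤ c)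
    (h : ∀ i, i ∈ A' ↔ (i < j ∧ i ∈ A) ∨ (i = j + 1 ∧ P) ∨ (c + 1 < i ∧ i - 1 ∈ A)) :
    A'.card + (A.filter fun i => j ≤ i ∧ i ≤ c).card = A.card + if P then 1 else 0 := by
  have hA' : A' = (A.filter (· < j)) ∪ ((if P then {j + 1} else ∅) ∪
      (A.filter (c < ·)).map (addRightEmbedding 1)) := by
    ext i
    simp only [h, Finset.mem_union, Finset.mem_filter, Finset.mem_map, addRightEmbedding_apply]
    constructor
    · rintro (h | h | h)
      · exact Or.inl h.symm
      · simp [h.1, h.2]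
      · exact Or.inr (Or.inr ⟨i - 1, ⟨h.2, by omega⟩, by omega⟩)
    · rintro (h | h | ⟨b, h, rfl⟩)
      · exact Or.inl h.symm
      · split_ifs at h with hP
        · exact Or.inr (Or.inl ⟨by simpa using h, hP⟩)
        · simp at h
      · exact Or.inr (Or.inr ⟨by omega, by simpa using h.1⟩)
  have d2 : Disjoint (if P then {j + 1} else ∅ : Finset ℕ)
      ((A.filter (c < ·)).map (addRightEmbedding 1)) := by
    rw [Finset.disjoint_left]
    intro i hi hi'
    split_ifs at hi
    · simp only [Finset.mem_singleton] at hi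
      simp only [Finset.mem_map, Finset.mem_filter, addRightEmbedding_apply] at hi'
      obtain ⟨b, hb, rfl⟩ := hi'
      omega
    · simp at hi
  have d1 : Disjoint (A.filter (· < j)) ((if P then {j + 1} else ∅) ∪
      (A.filter (c < ·)).map (addRightEmbedding 1)) := by
    rw [Finset.disjoint_left]
    intro i hi hi'
    simp only [Finset.mem_filter] at hi
    rcases Finset.mem_union.1 hi' with h' | h'
    · split_ifs at h'
      · simp only [Finset.mem_singleton] at h'
        omega
      · simp at h'
    · simp only [Finset.mem_map, Finset.mem_filter, addRightEmbedding_apply] at h'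
      obtain ⟨b, hb, rfl⟩ := h'
      omega
  have hA : A.card = (A.filter (· < j)).card +
      ((A.filter fun i => j ≤ i ∧ i ≤ c).card + (A.filter (c < ·)).card) := by
    rw [← Finset.card_union_of_disjoint, ← Finset.card_union_of_disjoint]
    · congr 1
      ext i
      simp only [Finset.mem_union, Finset.mem_filter]
      constructor
      · intro hi
        simp only [hi, true_and]
        omega
      · tauto
    · rw [Finset.disjoint_left]
      intro i
      simp only [Finset.mem_union, Finset.mem_filter]
      omega
    · rw [Finset.disjoint_left]
      intro i
      simp only [Finset.mem_filter]
      omega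
  rw [hA', Finset.card_union_of_disjoint d1, Finset.card_union_of_disjoint d2, Finset.card_map, hA]
  split_ifs <;> simp <;> omega

theorem des_insertIdx {w : List ℕ} {a j : ℕ} (ha0 : 0 < a) (ha : ∀ b ∈ w, b < a)
    (hj : j ≤ w.length) :
    des (w.insertIdx j a) + (if j ∈ descents w then 1 else 0) =
      des w + if j < w.length then 1 else 0 := by
  have := card_of_mem_iff_shift le_rfl (mem_descents_insertIdx ha0 ha hj)
  rw [des, des, ← this]
  congr 1
  have : ((descents w).filter fun i => j ≤ i ∧ i ≤ j) = (descents w).filter (· = j) := by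
    congr 1
    ext i
    omega
  rw [this, Finset.filter_eq']
  split_ifs <;> simp

/-- Adjacent indices are never both peaks, so at most one peak is lost. -/
theorem pk_insertIdx {w : List ℕ} {a j : ℕ} (ha0 : 0 < a) (ha : ∀ b ∈ w, b < a)
    (hj : j ≤ w.length) :
    pk (w.insertIdx j a) + (if j ∈ peaks w ∨ j + 1 ∈ peaks w then 1 else 0) =
      pk w + if 0 < j ∧ j < w.length then 1 else 0 := by
  have := card_of_mem_iff_shift (Nat.le_succ j) (mem_peaks_insertIdx ha0 ha hj)
  rw [pk, pk, ← this]
  congr 1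
  by_cases h1 : j ∈ peaks w
  · rw [if_pos (Or.inl h1), eq_comm, Finset.card_eq_one]
    refine ⟨j, ?_⟩
    ext i
    simp only [Finset.mem_filter, Finset.mem_singleton]
    constructor
    · rintro ⟨hi, hji, hij⟩
      rcases Nat.lt_or_eq_of_le hji with h | h
      · exact absurd (show j + 1 ∈ peaks w by rwa [show j + 1 = i by omega])
          (succ_notMem_peaks h1)
      · exact h.symm
    · rintro rfl
      exact ⟨h1, le_rfl, Nat.le_succ _⟩
  · by_cases h2 : j + 1 ∈ peaks w
    · rw [if_pos (Or.inr h2), eq_comm, Finset.card_eq_one]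
      refine ⟨j + 1, ?_⟩
      ext i
      simp only [Finset.mem_filter, Finset.mem_singleton]
      constructor
      · rintro ⟨hi, hji, hij⟩
        rcases Nat.lt_or_eq_of_le hji with h | h
        · omega
        · exact absurd (h ▸ hi) h1
      · rintro rfl
        exact ⟨h2, Nat.le_succ _, le_rfl⟩
    · rw [if_neg (by tauto), eq_comm, Finset.card_eq_zero, Finset.filter_eq_empty_iff]
      intro i hi hij
      rcases Nat.lt_or_eq_of_le hij.1 with h | h
      · exact h2 (by rwa [show j + 1 = i by omega])
      · exact h1 (h ▸ hi)

/-- The maximum is never the lower letter of a descent, so a new double descent must begin with it.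
-/
theorem hasDoubleDescent_insertIdx {w : List ℕ} {a j : ℕ} (ha0 : 0 < a) (ha : ∀ b ∈ w, b < a)
    (hj : j ≤ w.length) (hw : ¬ HasDoubleDescent w) :
    HasDoubleDescent (w.insertIdx j a) ↔ j + 1 ∈ descents w := by
  rw [hasDoubleDescent_iff] at hw ⊢
  have key := mem_descents_insertIdx ha0 ha hj
  constructor
  · rintro ⟨i, h1, h2⟩
    rw [key, Nat.add_sub_cancel] at h2
    rw [key] at h1
    rcases h1 with h1 | h1 | h1 <;> rcases h2 with h2 | h2 | h2 <;> try omega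
    · exact absurd ⟨i, h1.2, h2.2⟩ hw
    · rw [← h1.1]; exact h2.2
    · exact absurd ⟨i - 1, h1.2, by rw [Nat.sub_add_cancel (by omega)]; exact h2.2⟩ hw
  · intro h
    have := (mem_descents.1 h).1.2
    refine ⟨j + 1, (key _).2 (Or.inr (Or.inl ⟨rfl, by omega⟩)),
      (key _).2 (Or.inr (Or.inr ⟨by omega, by simpa using h⟩))⟩

/-! ### Words of permutations -/

/-- `w` is the word of a permutation of `[n]`. -/
def IsPermWord (n : ℕ) (w : List ℕ) : Prop := w.Perm (List.range' 1 n)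

theorem IsPermWord.length_eq {n : ℕ} {w : List ℕ} (h : IsPermWord n w) : w.length = n := by
  simpa using List.Perm.length_eq h

theorem IsPermWord.mem_iff {n : ℕ} {w : List ℕ} (h : IsPermWord n w) {a : ℕ} :
    a ∈ w ↔ 1 ≤ a ∧ a ≤ n := by
  rw [List.Perm.mem_iff h, List.mem_range'_1]
  omega

theorem IsPermWord.lt_succ {n : ℕ} {w : List ℕ} (h : IsPermWord n w) : ∀ b ∈ w, b < n + 1 :=
  fun _ hb => Nat.lt_succ_of_le (h.mem_iff.1 hb).2

theorem IsPermWord.succ_notMem {n : ℕ} {w : List ℕ} (h : IsPermWord n w) : n + 1 ∉ w :=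
  fun hb => lt_irrefl _ (h.lt_succ _ hb)

theorem IsPermWord.insertIdx {n j : ℕ} {w : List ℕ} (h : IsPermWord n w) (hj : j ≤ n) :
    IsPermWord (n + 1) (w.insertIdx j (n + 1)) := by
  unfold IsPermWord
  rw [List.range'_concat, one_mul, Nat.add_comm 1 n]
  exact ((List.perm_insertIdx _ _ (by rw [h.length_eq]; exact hj)).trans (h.cons _)).trans
    (List.perm_append_singleton _ _).symm

theorem IsPermWord.erase {n : ℕ} {w : List ℕ} (h : IsPermWord (n + 1) w) :
    IsPermWord n (w.erase (n + 1)) := by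
  have h2 : ((n + 1) :: w.erase (n + 1)).Perm ((n + 1) :: List.range' 1 n) := by
    refine (List.perm_cons_erase (h.mem_iff.2 ⟨by omega, le_rfl⟩)).symm.trans (h.trans ?_)
    rw [List.range'_concat, one_mul, Nat.add_comm 1 n]
    exact List.perm_append_singleton _ _
  exact (List.perm_cons _).1 h2

theorem IsPermWord.exists_eq_insertIdx {n : ℕ} {w : List ℕ} (h : IsPermWord (n + 1) w) :
    ∃ j ≤ n, w = (w.erase (n + 1)).insertIdx j (n + 1) := by
  obtain ⟨j, hj, e⟩ := exists_insertIdx_of_mem (h.mem_iff.2 ⟨by omega, le_rfl⟩)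
  exact ⟨j, by rwa [h.erase.length_eq] at hj, e⟩

theorem IsPermWord.erase_insertIdx {n j : ℕ} {w : List ℕ} (h : IsPermWord n w) (hj : j ≤ n) :
    (w.insertIdx j (n + 1)).erase (n + 1) = w :=
  Simsun.erase_insertIdx (by rwa [h.length_eq]) h.succ_notMem

theorem IsPermWord.insertIdx_inj {n j j' : ℕ} {w w' : List ℕ} (h : IsPermWord n w)
    (h' : IsPermWord n w') (hj : j ≤ n) (hj' : j' ≤ n)
    (e : w.insertIdx j (n + 1) = w'.insertIdx j' (n + 1)) : w = w' ∧ j = j' :=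
  Simsun.insertIdx_inj (by rwa [h.length_eq]) (by rwa [h'.length_eq]) h.succ_notMem
    h'.succ_notMem e

theorem IsSimsun.not_hasDoubleDescent {n : ℕ} {w : List ℕ} (h : IsPermWord n w)
    (hs : IsSimsun w) : ¬ HasDoubleDescent w := by
  rcases Nat.eq_zero_or_pos n with rfl | hn
  · rw [List.eq_nil_of_length_eq_zero h.length_eq]
    decide
  · have h1 := hs n (by simp [h.length_eq]; omega)
    rwa [List.filter_eq_self.2 (fun a ha => by simpa using (h.mem_iff.1 ha).2)] at h1

/-- The subwords on letters at most `k ≤ n` do not see `n + 1`; only the full word imposes a new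
condition. -/
theorem IsPermWord.isSimsun_insertIdx {n j : ℕ} {w : List ℕ} (h : IsPermWord n w) (hj : j ≤ n) :
    IsSimsun (w.insertIdx j (n + 1)) ↔ IsSimsun w ∧ j + 1 ∉ descents w := by
  have hfull : (w.insertIdx j (n + 1)).filter (fun a => a ≤ n + 1) = w.insertIdx j (n + 1) :=
    List.filter_eq_self.2 (fun a ha => by simpa using ((h.insertIdx hj).mem_iff.1 ha).2)
  have hsmall : ∀ k ≤ n, (w.insertIdx j (n + 1)).filter (fun a => a ≤ k) =
      w.filter (fun a => a ≤ k) := fun k hk => filter_insertIdx (by simp; omega) _ _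
  have hdd := fun hw => hasDoubleDescent_insertIdx (Nat.succ_pos n) h.lt_succ
    (j := j) (by rwa [h.length_eq]) hw
  constructor
  · intro hs
    have hw : IsSimsun w := by
      intro k hk
      rw [Finset.mem_Icc, h.length_eq] at hk
      have := hs k (by rw [Finset.mem_Icc, (h.insertIdx hj).length_eq]; omega)
      rwa [hsmall k hk.2] at this
    refine ⟨hw, ?_⟩
    rw [← hdd (hw.not_hasDoubleDescent h)]
    exact hs.not_hasDoubleDescent (h.insertIdx hj)
  · rintro ⟨hw, hd⟩ k hk
    rw [Finset.mem_Icc, (h.insertIdx hj).length_eq] at hk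
    rcases Nat.lt_or_eq_of_le hk.2 with hk' | rfl
    · rw [hsmall k (by omega)]
      exact hw k (by rw [Finset.mem_Icc, h.length_eq]; omega)
    · rw [hfull, hdd (hw.not_hasDoubleDescent h)]
      exact hd

/-! ### Labels -/

theorem mem_yPositions {w : List ℕ} {i : ℕ} :
    i ∈ yPositions w ↔ i < w.length ∧ i ∉ descents w ∧ i + 1 ∉ descents w := by
  simp only [yPositions, Finset.mem_sdiff, Finset.mem_range, Finset.mem_union, Finset.mem_image,
    not_or, not_exists, not_and]
  refine and_congr_right fun _ => and_congr_right fun _ => ⟨fun h h' => h _ h' rfl, ?_⟩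
  rintro h j hj rfl
  rw [Nat.sub_add_cancel (mem_descents.1 hj).1.1] at h
  exact h hj

theorem mem_qPositions {v : List ℕ} {j : ℕ} :
    j ∈ qPositions v ↔ (1 ≤ j ∧ j < v.length) ∧ j ∉ peaks v ∧ j + 1 ∉ peaks v := by
  simp only [qPositions, Finset.mem_sdiff, Finset.mem_Icc, Finset.mem_union, Finset.mem_image,
    not_or, not_exists, not_and]
  refine and_congr (by omega) (and_congr_right fun _ => ⟨fun h h' => h _ h' rfl, ?_⟩)
  rintro h i hi rfl
  rw [Nat.sub_add_cancel (by have := (mem_peaks.1 hi).1.1; omega)] at h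
  exact h hi

/-- Without consecutive elements, `A` and its shift `A - 1` are disjoint. This serves both the `y`-
and the `q`-labels. -/
theorem card_sdiff_union_image_pred {A U : Finset ℕ} (hA : ∀ i ∈ A, 1 ≤ i ∧ i + 1 ∉ A)
    (hU : ∀ i ∈ A, i ∈ U ∧ i - 1 ∈ U) :
    (U \ (A ∪ A.image fun i => i - 1)).card + 2 * A.card = U.card := by
  have hsub : A ∪ A.image (fun i => i - 1) ⊆ U := by
    intro i hi
    rcases Finset.mem_union.1 hi with h | h
    · exact (hU i h).1
    · obtain ⟨b, hb, rfl⟩ := Finset.mem_image.1 h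
      exact (hU b hb).2
  have hcard : (A ∪ A.image (fun i => i - 1)).card = A.card + A.card := by
    rw [Finset.card_union_of_disjoint, Finset.card_image_of_injOn]
    · intro a ha b hb hab
      have h1 := (hA a ha).1
      have h2 := (hA b hb).1
      simp only at hab
      omega
    · rw [Finset.disjoint_left]
      intro a ha h
      obtain ⟨b, hb, rfl⟩ := Finset.mem_image.1 h
      exact (hA _ ha).2 (by rwa [Nat.sub_add_cancel (hA b hb).1])
  have := Finset.card_sdiff_add_card_eq_card hsub
  omega

theorem card_yPositions {w : List ℕ} (hw : ¬ HasDoubleDescent w) :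
    (yPositions w).card + 2 * des w = w.length := by
  rw [hasDoubleDescent_iff] at hw
  have := card_sdiff_union_image_pred (A := descents w) (U := Finset.range w.length)
    (fun i hi => ⟨(mem_descents.1 hi).1.1, fun h => hw ⟨i, hi, h⟩⟩) (fun i hi => by
      have := (mem_descents.1 hi).1
      simp only [Finset.mem_range]
      omega)
  rwa [Finset.card_range] at this

theorem card_qPositions (v : List ℕ) : (qPositions v).card + 2 * pk v = v.length - 1 := by
  have := card_sdiff_union_image_pred (A := peaks v) (U := Finset.Icc 1 (v.length - 1))
    (fun i hi => ⟨by have := (mem_peaks.1 hi).1; omega, succ_notMem_peaks hi⟩) (fun i hi => by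
      have := (mem_peaks.1 hi).1
      simp only [Finset.mem_Icc]
      omega)
  rwa [Nat.card_Icc, Nat.add_sub_cancel] at this

/-- `i` has the same rank in `A` as `j` has in `B`. -/
def SameRank (A B : Finset ℕ) (i j : ℕ) : Prop := ∃ r, IsNth A r i ∧ IsNth B r j

theorem SameRank.mem_left {A B : Finset ℕ} {i j : ℕ} (h : SameRank A B i j) : i ∈ A :=
  h.choose_spec.1.1

theorem SameRank.mem_right {A B : Finset ℕ} {i j : ℕ} (h : SameRank A B i j) : j ∈ B :=
  h.choose_spec.2.1

theorem SameRank.symm {A B : Finset ℕ} {i j : ℕ} (h : SameRank A B i j) : SameRank B A j i :=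
  let ⟨r, h1, h2⟩ := h
  ⟨r, h2, h1⟩

theorem injOn_card_filter_le (A : Finset ℕ) :
    Set.InjOn (fun i => (A.filter fun j => j ≤ i).card) (A : Set ℕ) := by
  have key : ∀ a b, b ∈ A → a < b →
      (A.filter fun j => j ≤ a).card < (A.filter fun j => j ≤ b).card := by
    intro a b hb hab
    refine Finset.card_lt_card (Finset.ssubset_iff_of_subset ?_ |>.2 ⟨b, ?_, ?_⟩)
    · intro j hj
      simp only [Finset.mem_filter] at hj ⊢
      exact ⟨hj.1, by omega⟩
    · simp [hb]
    · simp [hab]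
  intro a ha b hb hab
  rcases lt_trichotomy a b with h | h | h
  · exact absurd hab (key a b hb h).ne
  · exact h
  · exact absurd hab (key b a ha h).ne'

theorem exists_isNth {A : Finset ℕ} {r : ℕ} (h1 : 1 ≤ r) (h2 : r ≤ A.card) :
    ∃ i, IsNth A r i := by
  have hmaps : Set.MapsTo (fun i => (A.filter fun j => j ≤ i).card) (A : Set ℕ)
      (Finset.Icc 1 A.card : Finset ℕ) := by
    intro i hi
    simp only [Finset.coe_Icc, Set.mem_Icc]
    exact ⟨Finset.card_pos.2 ⟨i, by simpa using hi⟩, Finset.card_filter_le _ _⟩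
  -- The rank is an injection from `A` to a set of the same size, hence onto.
  obtain ⟨i, hi, e⟩ := Finset.surjOn_of_injOn_of_card_le _ hmaps (injOn_card_filter_le A)
    (by simp) (show r ∈ ((Finset.Icc 1 A.card : Finset ℕ) : Set ℕ) by simp [h1, h2])
  exact ⟨i, hi, e⟩

theorem existsUnique_sameRank {A B : Finset ℕ} (h : A.card = B.card) {i : ℕ} (hi : i ∈ A) :
    ∃! j, SameRank A B i j := by
  obtain ⟨j, hj⟩ := exists_isNth (A := B) (r := (A.filter fun j => j ≤ i).card)
    (Finset.card_pos.2 ⟨i, by simpa using hi⟩) (h ▸ Finset.card_filter_le _ _)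
  refine ⟨j, ⟨_, ⟨hi, rfl⟩, hj⟩, ?_⟩
  rintro j' ⟨r, h1, h2⟩
  exact injOn_card_filter_le B h2.1 hj.1 (by simp only; rw [h2.2, hj.2, h1.2])

/-! ### One step of the correspondence -/

/-- Inserting the next letter into `v` at `j` corresponds to inserting the next letter into `w`
at `i`. -/
def Step (w v : List ℕ) (i j : ℕ) : Prop :=
  (i = w.length ∧ (j = 0 ∨ j = v.length)) ∨
    (SameRank (descents w) (peaks v) i j ∨ SameRank (descents w) (peaks v) i (j + 1)) ∨
      SameRank (yPositions w) (qPositions v) i j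

theorem phiRel_one_iff {w v : List ℕ} :
    PhiRel 1 w v ↔ w = [1] ∧ (v = [1, 2] ∨ v = [2, 1]) := by
  -- The relation starts at index 1, so no recursive constructor can end there.
  have h0 : ∀ w v, ¬ PhiRel 0 w v := fun w v h => by cases h
  constructor
  · intro h
    cases h with
    | one_left => exact ⟨rfl, Or.inl rfl⟩
    | one_right => exact ⟨rfl, Or.inr rfl⟩
    | front h => exact absurd h (h0 _ _)
    | back h => exact absurd h (h0 _ _)
    | x_before h => exact absurd h (h0 _ _)
    | x_after h => exact absurd h (h0 _ _)
    | y h => exact absurd h (h0 _ _)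
  · rintro ⟨rfl, rfl | rfl⟩
    · exact PhiRel.one_left
    · exact PhiRel.one_right

/-- Merges the five recursive constructors into one `Step`. The position `j - 1` before a peak `j`
is encoded by asking that `j + 1` be the peak, which avoids truncated subtraction. -/
theorem phiRel_succ_iff {m : ℕ} (hm : 1 ≤ m) {w' v' : List ℕ} :
    PhiRel (m + 1) w' v' ↔ ∃ w v i j, PhiRel m w v ∧ Step w v i j ∧
      w' = w.insertIdx i (m + 1) ∧ v' = v.insertIdx j (m + 2) := by
  constructor
  · intro h
    cases h with
    | one_left => omega
    | one_right => omega
    | front h =>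
      exact ⟨_, _, _, 0, h, Or.inl ⟨rfl, Or.inl rfl⟩, List.insertIdx_length_self.symm, rfl⟩
    | back h =>
      exact ⟨_, _, _, _, h, Or.inl ⟨rfl, Or.inr rfl⟩, List.insertIdx_length_self.symm,
        List.insertIdx_length_self.symm⟩
    | x_before h hi hj =>
      refine ⟨_, _, _, _, h, Or.inr (Or.inl (Or.inr ⟨_, hi, ?_⟩)), rfl, rfl⟩
      rwa [Nat.sub_add_cancel (by have := (mem_peaks.1 hj.1).1; omega)]
    | x_after h hi hj => exact ⟨_, _, _, _, h, Or.inr (Or.inl (Or.inl ⟨_, hi, hj⟩)), rfl, rfl⟩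
    | y h hi hj => exact ⟨_, _, _, _, h, Or.inr (Or.inr ⟨_, hi, hj⟩), rfl, rfl⟩
  · rintro ⟨w, v, i, j, h, (⟨rfl, rfl | rfl⟩ | (⟨r, hi, hj⟩ | ⟨r, hi, hj⟩) | ⟨r, hi, hj⟩),
      rfl, rfl⟩
    · rw [List.insertIdx_length_self]
      exact PhiRel.front h
    · rw [List.insertIdx_length_self, List.insertIdx_length_self]
      exact PhiRel.back h
    · exact PhiRel.x_after h hi hj
    · exact PhiRel.x_before h hi hj
    · exact PhiRel.y h hi hj

/-- The properties of corresponding words that make the recursive step work. -/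
structure Compatible (m : ℕ) (w v : List ℕ) : Prop where
  left : IsPermWord m w
  simsun : IsSimsun w
  right : IsPermWord (m + 1) v
  des_eq : des w = pk v

namespace Compatible

variable {m i j : ℕ} {w v : List ℕ}

theorem not_hasDoubleDescent (h : Compatible m w v) : ¬ HasDoubleDescent w :=
  h.simsun.not_hasDoubleDescent h.left

theorem card_positions_eq (h : Compatible m w v) :
    (yPositions w).card = (qPositions v).card := by
  have h1 := card_yPositions h.not_hasDoubleDescent
  have h2 := card_qPositions v
  rw [h.left.length_eq] at h1
  rw [h.right.length_eq, ← h.des_eq] at h2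
  omega

theorem step_iff_of_eq_length (h : Compatible m w v) (hi : i = m) :
    Step w v i j ↔ j = 0 ∨ j = m + 1 := by
  have h1 : i ∉ descents w := fun hd => by
    have := (mem_descents.1 hd).1.2
    rw [h.left.length_eq] at this
    omega
  have h2 : i ∉ yPositions w := fun hd => by
    have := (mem_yPositions.1 hd).1
    rw [h.left.length_eq] at this
    omega
  rw [Step, h.left.length_eq, h.right.length_eq]
  constructor
  · rintro (h' | (h' | h') | h')
    · exact h'.2
    · exact absurd h'.mem_left h1
    · exact absurd h'.mem_left h1
    · exact absurd h'.mem_left h2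
  · exact fun h' => Or.inl ⟨hi, h'⟩

theorem step_iff_of_mem_descents (hi : i ∈ descents w) :
    Step w v i j ↔
      SameRank (descents w) (peaks v) i j ∨ SameRank (descents w) (peaks v) i (j + 1) := by
  have h1 := (mem_descents.1 hi).1.2
  constructor
  · rintro (h' | h' | h')
    · omega
    · exact h'
    · exact absurd hi (mem_yPositions.1 h'.mem_left).2.1
  · exact fun h' => Or.inr (Or.inl h')

theorem step_iff_of_mem_yPositions (hi : i ∈ yPositions w) :
    Step w v i j ↔ SameRank (yPositions w) (qPositions v) i j := by
  have h1 := mem_yPositions.1 hi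
  constructor
  · rintro (h' | (h' | h') | h')
    · omega
    · exact absurd h'.mem_left h1.2.1
    · exact absurd h'.mem_left h1.2.1
    · exact h'
  · exact fun h' => Or.inr (Or.inr h')

/-- The positions of `v` split into the two ends, those beside a peak and the `q`-positions. Each
kind admits only one clause of `Step`, where equality of ranks determines `i`. -/
theorem existsUnique_step (h : Compatible m w v) (hj : j ≤ m + 1) : ∃! i, Step w v i j := by
  have hlen := h.right.length_eq
  have hD : (peaks v).card = (descents w).card := h.des_eq.symm
  by_cases h0 : j = 0 ∨ j = m + 1
  · refine ⟨m, (h.step_iff_of_eq_length rfl).2 h0, ?_⟩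
    rintro i (h' | (h' | h') | h')
    · rw [h'.1, h.left.length_eq]
    · have := (mem_peaks.1 h'.mem_right).1
      omega
    · have := (mem_peaks.1 h'.mem_right).1
      omega
    · have := (mem_qPositions.1 h'.mem_right).1
      omega
  · by_cases h1 : j ∈ peaks v
    · have h2 := succ_notMem_peaks h1
      have h3 : ∀ i, Step w v i j ↔ SameRank (peaks v) (descents w) j i := by
        refine fun i => ⟨?_, fun h' => Or.inr (Or.inl (Or.inl h'.symm))⟩
        rintro (h' | (h' | h') | h')
        · omega
        · exact h'.symm
        · exact absurd h'.mem_right h2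
        · exact absurd h1 (mem_qPositions.1 h'.mem_right).2.1
      simp only [h3]
      exact existsUnique_sameRank hD h1
    · by_cases h2 : j + 1 ∈ peaks v
      · have h3 : ∀ i, Step w v i j ↔ SameRank (peaks v) (descents w) (j + 1) i := by
          refine fun i => ⟨?_, fun h' => Or.inr (Or.inl (Or.inr h'.symm))⟩
          rintro (h' | (h' | h') | h')
          · omega
          · exact absurd h'.mem_right h1
          · exact h'.symm
          · exact absurd h2 (mem_qPositions.1 h'.mem_right).2.2
        simp only [h3]
        exact existsUnique_sameRank hD h2
      · have h3 : ∀ i, Step w v i j ↔ SameRank (qPositions v) (yPositions w) j i := by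
          refine fun i => ⟨?_, fun h' => Or.inr (Or.inr h'.symm)⟩
          rintro (h' | (h' | h') | h')
          · omega
          · exact absurd h'.mem_right h1
          · exact absurd h'.mem_right h2
          · exact h'.symm
        simp only [h3]
        exact existsUnique_sameRank h.card_positions_eq.symm
          (mem_qPositions.2 ⟨by omega, h1, h2⟩)

theorem cases_of_succ_notMem (h : Compatible m w v) (hi : i ≤ m) (hd : i + 1 ∉ descents w) :
    i = m ∨ i ∈ descents w ∨ i ∈ yPositions w := by
  by_cases h1 : i = m
  · exact Or.inl h1
  · by_cases h2 : i ∈ descents w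
    · exact Or.inr (Or.inl h2)
    · exact Or.inr (Or.inr (mem_yPositions.2 ⟨by rw [h.left.length_eq]; omega, h2, hd⟩))

theorem step_bounds (h : Compatible m w v) (hs : Step w v i j) :
    i ≤ m ∧ j ≤ m + 1 ∧ i + 1 ∉ descents w := by
  have hw := h.left.length_eq
  have hv := h.right.length_eq
  have hdd := h.not_hasDoubleDescent
  rw [hasDoubleDescent_iff] at hdd
  rcases hs with h' | (h' | h') | h'
  · refine ⟨by omega, by omega, fun hd => ?_⟩
    have := (mem_descents.1 hd).1
    omega
  · have h1 := (mem_descents.1 h'.mem_left).1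
    have h2 := (mem_peaks.1 h'.mem_right).1
    exact ⟨by omega, by omega, fun hd => hdd ⟨_, h'.mem_left, hd⟩⟩
  · have h1 := (mem_descents.1 h'.mem_left).1
    have h2 := (mem_peaks.1 h'.mem_right).1
    exact ⟨by omega, by omega, fun hd => hdd ⟨_, h'.mem_left, hd⟩⟩
  · have h1 := mem_yPositions.1 h'.mem_left
    have h2 := (mem_qPositions.1 h'.mem_right).1
    exact ⟨by omega, by omega, h1.2.2⟩

open Classical in
theorem card_step (h : Compatible m w v) (hi : i ≤ m) (hd : i + 1 ∉ descents w) :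
    ((Finset.range (m + 2)).filter (Step w v i)).card = if i ∈ yPositions w then 1 else 2 := by
  rcases h.cases_of_succ_notMem hi hd with h1 | h1 | h1
  · rw [if_neg fun h2 => by
      have := (mem_yPositions.1 h2).1
      rw [h.left.length_eq] at this
      omega]
    rw [show (Finset.range (m + 2)).filter (Step w v i) = {0, m + 1} from ?_,
      Finset.card_pair (by omega)]
    ext j
    rw [Finset.mem_filter, h.step_iff_of_eq_length h1, Finset.mem_range, Finset.mem_insert,
      Finset.mem_singleton]
    omega
  · rw [if_neg fun h2 => (mem_yPositions.1 h2).2.1 h1]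
    obtain ⟨b, hb, hu⟩ := existsUnique_sameRank (A := descents w) (B := peaks v) h.des_eq h1
    have hb' := (mem_peaks.1 hb.mem_right).1
    rw [h.right.length_eq] at hb'
    rw [show (Finset.range (m + 2)).filter (Step w v i) = {b, b - 1} from ?_,
      Finset.card_pair (by omega)]
    ext j
    rw [Finset.mem_filter, step_iff_of_mem_descents h1, Finset.mem_range, Finset.mem_insert,
      Finset.mem_singleton]
    constructor
    · rintro ⟨_, h' | h'⟩
      · exact Or.inl (hu _ h')
      · have := hu _ h'
        omega
    · rintro (rfl | rfl)
      · exact ⟨by omega, Or.inl hb⟩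
      · exact ⟨by omega, Or.inr (by rwa [Nat.sub_add_cancel (by omega)])⟩
  · rw [if_pos h1]
    obtain ⟨b, hb, hu⟩ := existsUnique_sameRank h.card_positions_eq h1
    have hb' := (mem_qPositions.1 hb.mem_right).1
    rw [h.right.length_eq] at hb'
    rw [Finset.card_eq_one]
    refine ⟨b, ?_⟩
    ext j
    rw [Finset.mem_filter, step_iff_of_mem_yPositions h1, Finset.mem_range, Finset.mem_singleton]
    constructor
    · exact fun h' => hu _ h'.2
    · rintro rfl
      exact ⟨by omega, hb⟩

end Compatible

theorem IsPermWord.des_insertIdx {m i : ℕ} {w : List ℕ} (h : IsPermWord m w) (hi : i ≤ m)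
    (hd : i + 1 ∉ descents w) :
    des (w.insertIdx i (m + 1)) = des w + if i ∈ yPositions w then 1 else 0 := by
  have := Simsun.des_insertIdx (Nat.succ_pos m) h.lt_succ (j := i) (by rwa [h.length_eq])
  rw [h.length_eq] at this
  simp only [mem_yPositions, h.length_eq, hd, not_false_eq_true, and_true]
  by_cases h1 : i ∈ descents w
  · have := (mem_descents.1 h1).1.2
    rw [h.length_eq] at this
    simp_all
  · simp_all

namespace Compatible

variable {m i j : ℕ} {w v : List ℕ}

/-- The increment is the one for `des` in `IsPermWord.des_insertIdx`, so `des w = pk v` survives the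
step. -/
theorem pk_insertIdx (h : Compatible m w v) (hs : Step w v i j) :
    pk (v.insertIdx j (m + 2)) = pk v + if i ∈ yPositions w then 1 else 0 := by
  have hb := h.step_bounds hs
  have hv := h.right.length_eq
  have := Simsun.pk_insertIdx (Nat.succ_pos (m + 1)) h.right.lt_succ (j := j) (by omega)
  rw [hv] at this
  rcases h.cases_of_succ_notMem hb.1 hb.2.2 with h1 | h1 | h1
  · rw [h.step_iff_of_eq_length h1] at hs
    rw [if_neg fun h2 => by
      have := (mem_yPositions.1 h2).1
      rw [h.left.length_eq] at this
      omega]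
    rw [if_neg, if_neg] at this
    · exact this
    · omega
    · rintro (h' | h') <;> have := (mem_peaks.1 h').1 <;> omega
  · rw [if_neg fun h2 => (mem_yPositions.1 h2).2.1 h1]
    rw [step_iff_of_mem_descents h1] at hs
    have hp : j ∈ peaks v ∨ j + 1 ∈ peaks v := hs.imp SameRank.mem_right SameRank.mem_right
    rw [if_pos hp, if_pos] at this
    · exact Nat.add_right_cancel this
    · rcases hp with h' | h' <;> have := (mem_peaks.1 h').1 <;> omega
  · rw [if_pos h1]
    rw [step_iff_of_mem_yPositions h1] at hs
    have hq := mem_qPositions.1 hs.mem_right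
    rw [if_neg (not_or.2 hq.2), if_pos (by omega)] at this
    exact this

theorem insertIdx (h : Compatible m w v) (hs : Step w v i j) :
    Compatible (m + 1) (w.insertIdx i (m + 1)) (v.insertIdx j (m + 2)) := by
  have hb := h.step_bounds hs
  exact ⟨h.left.insertIdx hb.1, (h.left.isSimsun_insertIdx hb.1).2 ⟨h.simsun, hb.2.2⟩,
    h.right.insertIdx hb.2.1, by
      rw [h.left.des_insertIdx hb.1 hb.2.2, h.pk_insertIdx hs, h.des_eq]⟩

end Compatible

/-! ### The correspondence on words, by induction on the length -/

theorem isPermWord_one_iff {w : List ℕ} : IsPermWord 1 w ↔ w = [1] := by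
  simp [IsPermWord]

theorem isPermWord_two_iff {w : List ℕ} : IsPermWord 2 w ↔ w = [1, 2] ∨ w = [2, 1] := by
  rw [IsPermWord, ← List.mem_permutations,
    show (List.range' 1 2).permutations = [[1, 2], [2, 1]] by
      simp [List.permutations, List.range']]
  simp

theorem PhiRel.compatible {n : ℕ} (hn : 1 ≤ n) :
    ∀ {w v : List ℕ}, PhiRel n w v → Compatible n w v := by
  induction n, hn using Nat.le_induction with
  | base =>
    intro w v h
    obtain ⟨rfl, hv⟩ := phiRel_one_iff.1 h
    refine ⟨isPermWord_one_iff.2 rfl, by decide, isPermWord_two_iff.2 hv, ?_⟩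
    rcases hv with rfl | rfl <;> decide
  | succ m hm ih =>
    intro w v h
    obtain ⟨w, v, i, j, h', hs, rfl, rfl⟩ := (phiRel_succ_iff hm).1 h
    exact (ih h').insertIdx hs

/-- Deleting the largest letter of `v` leaves a word with a unique partner, and the deleted position
then determines where the letter goes in that partner. -/
theorem existsUnique_phiRel {n : ℕ} (hn : 1 ≤ n) :
    ∀ {v : List ℕ}, IsPermWord (n + 1) v → ∃! w, PhiRel n w v := by
  induction n, hn using Nat.le_induction with
  | base =>
    intro v hv
    exact ⟨[1], phiRel_one_iff.2 ⟨rfl, isPermWord_two_iff.1 hv⟩,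
      fun w hw => (phiRel_one_iff.1 hw).1⟩
  | succ m hm ih =>
    intro v hv
    obtain ⟨j, hj, e⟩ := hv.exists_eq_insertIdx
    obtain ⟨w, hw, huw⟩ := ih hv.erase
    have hc := hw.compatible hm
    obtain ⟨i, hi, hui⟩ := hc.existsUnique_step hj
    refine ⟨w.insertIdx i (m + 1), (phiRel_succ_iff hm).2 ⟨w, _, i, j, hw, hi, rfl, e⟩, ?_⟩
    intro w' hw'
    obtain ⟨w₁, v₁, i₁, j₁, h₁, hs₁, rfl, e₁⟩ := (phiRel_succ_iff hm).1 hw'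
    have hc₁ := h₁.compatible hm
    obtain ⟨hv₁, rfl⟩ := hc₁.right.insertIdx_inj hc.right (hc₁.step_bounds hs₁).2.1 hj
      (e₁.symm.trans e)
    rw [hv₁] at h₁ hs₁
    obtain rfl := huw _ h₁
    rw [hui _ hs₁]

/-- The words of the permutations of `[n]`. -/
def permWords (n : ℕ) : Finset (List ℕ) := (List.range' 1 n).permutations.toFinset

theorem mem_permWords {n : ℕ} {w : List ℕ} : w ∈ permWords n ↔ IsPermWord n w := by
  rw [permWords, List.mem_toFinset, List.mem_permutations, IsPermWord]

open Classical in
theorem card_filter_phiRel {n : ℕ} (hn : 1 ≤ n) :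
    ∀ {w : List ℕ}, IsPermWord n w → IsSimsun w →
      ((permWords (n + 1)).filter (PhiRel n w)).card = 2 ^ (n - des w) := by
  induction n, hn using Nat.le_induction with
  | base =>
    intro w hw _
    obtain rfl := isPermWord_one_iff.1 hw
    rw [show (permWords 2).filter (PhiRel 1 [1]) = {[1, 2], [2, 1]} from ?_]
    · decide
    · ext v
      simp [mem_permWords, isPermWord_two_iff, phiRel_one_iff]
  | succ m hm ih =>
    intro w' hw' hs'
    obtain ⟨i, hi, e⟩ := hw'.exists_eq_insertIdx
    have hw := hw'.erase
    generalize w'.erase (m + 1) = w at e hw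
    subst e
    obtain ⟨hs, hd⟩ := (hw.isSimsun_insertIdx hi).1 hs'
    -- The partners of the longer word are counted by fibres of the deletion of the largest letter;
    -- `card_step` gives the size of each fibre.
    have hmaps : Set.MapsTo (fun v' : List ℕ => v'.erase (m + 2))
        ((permWords (m + 2)).filter (PhiRel (m + 1) (w.insertIdx i (m + 1))) : Finset (List ℕ))
        ((permWords (m + 1)).filter (PhiRel m w) : Finset (List ℕ)) := by
      intro v' hv'
      simp only [Finset.coe_filter, mem_permWords, Set.mem_ofPred_eq] at hv' ⊢
      refine ⟨hv'.1.erase, ?_⟩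
      obtain ⟨w₁, v₁, i₁, j₁, h₁, hs₁, e₁, rfl⟩ := (phiRel_succ_iff hm).1 hv'.2
      have hc := h₁.compatible hm
      obtain ⟨rfl, _⟩ := hw.insertIdx_inj hc.left hi (hc.step_bounds hs₁).1 e₁
      rwa [hc.right.erase_insertIdx (hc.step_bounds hs₁).2.1]
    have hfiber : ∀ v ∈ (permWords (m + 1)).filter (PhiRel m w),
        (((permWords (m + 2)).filter (PhiRel (m + 1) (w.insertIdx i (m + 1)))).filter
          fun v' => v'.erase (m + 2) = v).card = if i ∈ yPositions w then 1 else 2 := by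
      intro v hv
      have hv := (Finset.mem_filter.1 hv).2
      have hc := hv.compatible hm
      rw [← hc.card_step hi hd, ← Finset.card_image_of_injOn (f := fun j => v.insertIdx j (m + 2))]
      · congr 1
        ext v'
        simp only [Finset.mem_filter, Finset.mem_image, mem_permWords, Finset.mem_range]
        constructor
        · rintro ⟨⟨hv', h'⟩, rfl⟩
          obtain ⟨w₁, v₁, i₁, j₁, h₁, hs₁, e₁, rfl⟩ := (phiRel_succ_iff hm).1 h'
          have hc₁ := h₁.compatible hm
          have hb := hc₁.step_bounds hs₁
          obtain ⟨rfl, rfl⟩ := hw.insertIdx_inj hc₁.left hi hb.1 e₁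
          rw [hc₁.right.erase_insertIdx hb.2.1]
          exact ⟨j₁, ⟨by omega, hs₁⟩, rfl⟩
        · rintro ⟨j, ⟨hj, hst⟩, rfl⟩
          exact ⟨⟨hc.right.insertIdx (by omega),
            (phiRel_succ_iff hm).2 ⟨w, v, i, j, hv, hst, rfl, rfl⟩⟩,
            hc.right.erase_insertIdx (by omega)⟩
      · intro j hj j' hj' e
        simp only [Finset.coe_filter, Finset.mem_range, Set.mem_ofPred_eq] at hj hj'
        exact (hc.right.insertIdx_inj hc.right (by omega) (by omega) e).2
    rw [Finset.card_eq_sum_card_fiberwise hmaps, Finset.sum_congr rfl hfiber, Finset.sum_const,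
      smul_eq_mul, ih hw hs, hw.des_insertIdx hi hd]
    -- This bounds `des w` by `m`, so the exponent truly grows by one in the doubling case.
    have := card_yPositions (hs.not_hasDoubleDescent hw)
    rw [hw.length_eq] at this
    split_ifs
    · rw [mul_one]
      congr 1
      omega
    · rw [← pow_succ]
      congr 1
      omega

/-! ### The recursion for the numbers of simsun words -/

/-- The words of the simsun permutations of `[n]`. -/
def simsunWords (n : ℕ) : Finset (List ℕ) := (permWords n).filter IsSimsun

theorem mem_simsunWords {n : ℕ} {w : List ℕ} :
    w ∈ simsunWords n ↔ IsPermWord n w ∧ IsSimsun w := by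
  rw [simsunWords, Finset.mem_filter, mem_permWords]

/-- The end and the descents keep `des`, the `y`-positions raise it by one, and no other position is
admissible. -/
theorem card_filter_des_insertIdx {m : ℕ} {w : List ℕ} (hw : IsPermWord m w) (hs : IsSimsun w)
    (k : ℕ) :
    ((Finset.range (m + 1)).filter fun i =>
        i + 1 ∉ descents w ∧ des (w.insertIdx i (m + 1)) = k).card =
      if des w = k then k + 1 else if des w + 1 = k then m - 2 * des w else 0 := by
  have hdd := hs.not_hasDoubleDescent hw
  have hcard := card_yPositions hdd
  rw [hasDoubleDescent_iff] at hdd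
  have hlen := hw.length_eq
  have hD : ∀ i ∈ descents w, i < m := fun i hi => hlen ▸ (mem_descents.1 hi).1.2
  have hm : m ∉ descents w := fun h => lt_irrefl _ (hD m h)
  have key : ∀ i, i ∈ (Finset.range (m + 1)).filter (fun i =>
        i + 1 ∉ descents w ∧ des (w.insertIdx i (m + 1)) = k) ↔
      (i ∈ insert m (descents w) ∧ des w = k) ∨ (i ∈ yPositions w ∧ des w + 1 = k) := by
    intro i
    simp only [Finset.mem_filter, Finset.mem_range, Finset.mem_insert]
    constructor
    · rintro ⟨h1, h2, h3⟩
      rw [hw.des_insertIdx (by omega) h2] at h3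
      split_ifs at h3 with hy
      · exact Or.inr ⟨hy, h3⟩
      · refine Or.inl ⟨?_, h3⟩
        by_contra hcon
        rw [not_or] at hcon
        exact hy (mem_yPositions.2 ⟨by omega, hcon.2, h2⟩)
    · rintro (⟨h1 | h1, h3⟩ | ⟨h1, h3⟩)
      · have h2 : i + 1 ∉ descents w := fun h => by have := hD _ h; omega
        have h4 : i ∉ yPositions w := fun h => by have := (mem_yPositions.1 h).1; omega
        refine ⟨by omega, h2, ?_⟩
        rw [hw.des_insertIdx (by omega) h2, if_neg h4, h3, add_zero]
      · have h2 : i + 1 ∉ descents w := fun h => hdd ⟨i, h1, h⟩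
        have h4 : i ∉ yPositions w := fun h => (mem_yPositions.1 h).2.1 h1
        have h5 := hD i h1
        refine ⟨by omega, h2, ?_⟩
        rw [hw.des_insertIdx (by omega) h2, if_neg h4, h3, add_zero]
      · have h2 := mem_yPositions.1 h1
        refine ⟨by omega, h2.2.2, ?_⟩
        rw [hw.des_insertIdx (by omega) h2.2.2, if_pos h1, h3]
  by_cases h1 : des w = k
  · rw [if_pos h1, ← h1, des, ← Finset.card_insert_of_notMem hm]
    congr 1
    ext i
    rw [← des, h1, key]
    simp only [h1, and_true, or_iff_left_iff_imp]
    omega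
  · rw [if_neg h1]
    by_cases h2 : des w + 1 = k
    · rw [if_pos h2, show m - 2 * des w = (yPositions w).card by omega]
      congr 1
      ext i
      rw [key]
      simp [h1, h2]
    · rw [if_neg h2, Finset.card_eq_zero]
      ext i
      rw [key]
      simp [h1, h2]

theorem card_filter_des_simsunWords_succ (m k : ℕ) :
    ((simsunWords (m + 1)).filter fun w => des w = k).card =
      (k + 1) * ((simsunWords m).filter fun w => des w = k).card +
        (m - 2 * (k - 1)) * ((simsunWords m).filter fun w => des w + 1 = k).card := by
  have hmaps : Set.MapsTo (fun w' : List ℕ => w'.erase (m + 1))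
      ((simsunWords (m + 1)).filter fun w => des w = k : Finset (List ℕ))
      (simsunWords m : Finset (List ℕ)) := by
    intro w' hw'
    simp only [Finset.coe_filter, mem_simsunWords, Set.mem_ofPred_eq] at hw'
    obtain ⟨⟨hw', hs'⟩, _⟩ := hw'
    obtain ⟨i, hi, e⟩ := hw'.exists_eq_insertIdx
    rw [e, hw'.erase.isSimsun_insertIdx hi] at hs'
    exact mem_simsunWords.2 ⟨hw'.erase, hs'.1⟩
  have hfiber : ∀ w ∈ simsunWords m,
      (((simsunWords (m + 1)).filter fun w => des w = k).filter
        fun w' => w'.erase (m + 1) = w).card =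
      (if des w = k then k + 1 else 0) + if des w + 1 = k then m - 2 * (k - 1) else 0 := by
    intro w hw
    obtain ⟨hw, hs⟩ := mem_simsunWords.1 hw
    -- In the second branch `des w = k - 1`; writing `k - 1` makes the summand independent of `w`.
    trans if des w = k then k + 1 else if des w + 1 = k then m - 2 * des w else 0
    swap
    · split_ifs with h1 h2 h2
      · omega
      · rfl
      · rw [show k - 1 = des w by omega, zero_add]
      · rfl
    rw [← card_filter_des_insertIdx hw hs k,
      ← Finset.card_image_of_injOn (f := fun i => w.insertIdx i (m + 1))]
    · congr 1
      ext w'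
      simp only [Finset.mem_filter, Finset.mem_image, mem_simsunWords, Finset.mem_range]
      constructor
      · rintro ⟨⟨⟨hw', hs'⟩, hk⟩, rfl⟩
        obtain ⟨i, hi, e⟩ := hw'.exists_eq_insertIdx
        refine ⟨i, ⟨by omega, ?_, e ▸ hk⟩, e.symm⟩
        rw [e, hw.isSimsun_insertIdx hi] at hs'
        exact hs'.2
      · rintro ⟨i, ⟨hi, hd, hk⟩, rfl⟩
        have hi : i ≤ m := by omega
        exact ⟨⟨⟨hw.insertIdx hi, (hw.isSimsun_insertIdx hi).2 ⟨hs, hd⟩⟩, hk⟩,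
          hw.erase_insertIdx hi⟩
    · intro i hi i' hi' e
      simp only [Finset.coe_filter, Finset.mem_range, Set.mem_ofPred_eq] at hi hi'
      exact (hw.insertIdx_inj hw (by omega) (by omega) e).2
  rw [Finset.card_eq_sum_card_fiberwise hmaps, Finset.sum_congr rfl hfiber,
    Finset.sum_add_distrib, ← Finset.sum_filter, ← Finset.sum_filter, Finset.sum_const,
    Finset.sum_const, smul_eq_mul, smul_eq_mul, mul_comm, mul_comm (Finset.card _) (m - _)]

/-! ### Words and permutations -/

theorem isPermWord_word {n : ℕ} (π : Equiv.Perm (Fin n)) : IsPermWord n (word π) := by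
  refine (List.perm_ext_iff_of_nodup ?_ List.nodup_range').2 fun a => ?_
  · rw [word, List.nodup_ofFn]
    intro i j h
    exact π.injective (Fin.ext (Nat.add_right_cancel h))
  · rw [word, List.mem_ofFn, List.mem_range'_1]
    constructor
    · rintro ⟨i, rfl⟩
      have := (π i).2
      omega
    · rintro ⟨h1, h2⟩
      refine ⟨π.symm ⟨a - 1, by omega⟩, ?_⟩
      simp only [Equiv.apply_symm_apply]
      omega

theorem word_injective (n : ℕ) : Function.Injective (word (n := n)) := by
  intro π σ h
  ext i
  exact Nat.add_right_cancel (congrFun (List.ofFn_injective h) i)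

theorem IsPermWord.exists_word_eq {n : ℕ} {w : List ℕ} (h : IsPermWord n w) :
    ∃ π : Equiv.Perm (Fin n), word π = w := by
  have hmem : ∀ i : Fin n, w[(i : ℕ)]'(by rw [h.length_eq]; exact i.2) ∈ w :=
    fun i => List.getElem_mem _
  have hnd : w.Nodup := h.nodup_iff.2 List.nodup_range'
  let f : Fin n → Fin n := fun i =>
    ⟨w[(i : ℕ)]'(by rw [h.length_eq]; exact i.2) - 1, by
      have := h.mem_iff.1 (hmem i)
      omega⟩
  have hf : Function.Injective f := by
    intro i j hij
    have h1 := h.mem_iff.1 (hmem i)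
    have h2 := h.mem_iff.1 (hmem j)
    have h3 := Fin.mk.inj_iff.1 hij
    exact Fin.ext ((hnd.getElem_inj_iff).1 (show w[(i : ℕ)]'_ = w[(j : ℕ)]'_ by omega))
  refine ⟨Equiv.ofBijective f (Finite.injective_iff_bijective.1 hf), ?_⟩
  refine List.ext_getElem (by simp [word, h.length_eq]) fun i h1 h2 => ?_
  have := h.mem_iff.1 (List.getElem_mem h2)
  simp only [word, List.getElem_ofFn, Equiv.ofBijective_apply, f]
  omega

theorem card_filter_word (n : ℕ) (P : List ℕ → Prop) [DecidablePred P] :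
    (Finset.univ.filter fun π : Equiv.Perm (Fin n) => P (word π)).card =
      ((permWords n).filter P).card := by
  rw [← Finset.card_image_of_injective _ (word_injective n)]
  congr 1
  ext w
  simp only [Finset.mem_image, Finset.mem_filter, Finset.mem_univ, true_and, mem_permWords]
  constructor
  · rintro ⟨π, h, rfl⟩
    exact ⟨isPermWord_word π, h⟩
  · rintro ⟨h, hP⟩
    obtain ⟨π, rfl⟩ := h.exists_word_eq
    exact ⟨π, hP, rfl⟩

theorem mem_simsunPerms {n k : ℕ} {π : Equiv.Perm (Fin n)} :
    π ∈ simsunPerms n k ↔ IsSimsun (word π) ∧ des (word π) = k := by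
  simp [simsunPerms]

theorem mem_peakPerms {n k : ℕ} {σ : Equiv.Perm (Fin n)} :
    σ ∈ peakPerms n k ↔ pk (word σ) = k := by
  simp [peakPerms]

theorem S_eq_card (n k : ℕ) : S n k = ((simsunWords n).filter fun w => des w = k).card := by
  rw [S, simsunPerms, card_filter_word n fun w => IsSimsun w ∧ des w = k, simsunWords,
    Finset.filter_filter]

theorem S_succ_zero (n : ℕ) : S (n + 1) 0 = S n 0 := by
  rw [S_eq_card, S_eq_card, card_filter_des_simsunWords_succ]
  simp

theorem S_succ_succ (n k : ℕ) :
    S (n + 1) (k + 1) = (k + 2) * S n (k + 1) + (n - 2 * k) * S n k := by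
  rw [S_eq_card, S_eq_card, S_eq_card, card_filter_des_simsunWords_succ]
  simp

theorem S_zero_left (k : ℕ) : S 0 k = if k = 0 then 1 else 0 := by
  have h : simsunWords 0 = {[]} := by
    ext w
    rw [mem_simsunWords, IsPermWord, List.range'_zero, List.perm_nil, Finset.mem_singleton,
      and_iff_left_iff_imp]
    rintro rfl
    decide
  rw [S_eq_card, h, Finset.filter_singleton, show des [] = 0 from rfl]
  rcases eq_or_ne k 0 with rfl | hk
  · rfl
  · rw [if_neg hk.symm, if_neg hk, Finset.card_empty]

theorem S_eq_zero {n k : ℕ} (h : n / 2 < k) : S n k = 0 := by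
  rw [S_eq_card, Finset.card_eq_zero, Finset.filter_eq_empty_iff]
  intro w hw hk
  obtain ⟨hw, hs⟩ := mem_simsunWords.1 hw
  have := card_yPositions (hs.not_hasDoubleDescent hw)
  rw [hw.length_eq] at this
  omega

/-! ### The correspondence -/

theorem ncard_Phi {n : ℕ} (hn : 1 ≤ n) {π : Equiv.Perm (Fin n)} (h : IsSimsun (word π)) :
    (Phi π).ncard = 2 ^ (n - des (word π)) := by
  classical
  rw [← card_filter_phiRel hn (isPermWord_word π) h, ← card_filter_word, ← Set.ncard_coe_finset]
  congr 1
  ext σ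
  simp [Phi]

theorem Phi_subset {n k : ℕ} (hn : 1 ≤ n) {π : Equiv.Perm (Fin n)} (h : π ∈ simsunPerms n k) :
    Phi π ⊆ (peakPerms (n + 1) k : Set (Equiv.Perm (Fin (n + 1)))) := by
  intro σ hσ
  rw [Finset.mem_coe, mem_peakPerms, ← (PhiRel.compatible hn hσ).des_eq]
  exact (mem_simsunPerms.1 h).2

theorem existsUnique_mem_Phi {n k : ℕ} (hn : 1 ≤ n) {σ : Equiv.Perm (Fin (n + 1))}
    (h : σ ∈ peakPerms (n + 1) k) :
    ∃! π : Equiv.Perm (Fin n), π ∈ simsunPerms n k ∧ σ ∈ Phi π := by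
  obtain ⟨w, hw, hu⟩ := existsUnique_phiRel hn (isPermWord_word σ)
  have hc := hw.compatible hn
  obtain ⟨π, rfl⟩ := hc.left.exists_word_eq
  refine ⟨π, ⟨mem_simsunPerms.2 ⟨hc.simsun, hc.des_eq.trans (mem_peakPerms.1 h)⟩, hw⟩, ?_⟩
  rintro π' ⟨_, hπ'⟩
  exact word_injective n (hu _ hπ')

/-- The sets `Phi π` partition the permutations with `k` peaks into blocks of equal size. -/
theorem W_succ {n : ℕ} (hn : 1 ≤ n) (k : ℕ) : W (n + 1) k = 2 ^ (n - k) * S n k := by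
  classical
  have hdisj : Set.PairwiseDisjoint (simsunPerms n k : Set (Equiv.Perm (Fin n)))
      fun π => (Finset.univ.filter fun σ => σ ∈ Phi π) := by
    intro π hπ π' hπ' hne
    refine Finset.disjoint_left.2 fun σ h1 h2 => hne ?_
    replace h1 := (Finset.mem_filter.1 h1).2
    replace h2 := (Finset.mem_filter.1 h2).2
    exact (existsUnique_mem_Phi hn (Phi_subset hn hπ h1)).unique ⟨hπ, h1⟩ ⟨hπ', h2⟩
  have hunion : peakPerms (n + 1) k =
      (simsunPerms n k).biUnion fun π => Finset.univ.filter fun σ => σ ∈ Phi π := by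
    ext σ
    simp only [Finset.mem_biUnion, Finset.mem_filter, Finset.mem_univ, true_and]
    exact ⟨fun h => (existsUnique_mem_Phi hn h).exists,
      fun ⟨π, hπ, h⟩ => Phi_subset hn hπ h⟩
  have hcard : ∀ π ∈ simsunPerms n k,
      (Finset.univ.filter fun σ => σ ∈ Phi π).card = 2 ^ (n - k) := by
    intro π hπ
    obtain ⟨hs, rfl⟩ := mem_simsunPerms.1 hπ
    rw [← ncard_Phi hn hs, ← Set.ncard_coe_finset]
    congr 1
    ext σ
    simp
  rw [W, hunion, Finset.card_biUnion hdisj, Finset.sum_congr rfl hcard, Finset.sum_const,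
    smul_eq_mul, mul_comm, S]

/-! ### The closed formula -/

theorem binom_natCast (i j : ℕ) : binom i j = i.choose j := by simp [binom]

theorem binom_of_neg {i : ℕ} {j : ℤ} (h : j < 0) : binom i j = 0 := if_neg (not_le.2 h)

theorem binom_succ (i : ℕ) (j : ℤ) : binom (i + 1) (j + 1) = binom i j + binom i (j + 1) := by
  rcases lt_or_ge j 0 with h | h
  · rcases eq_or_ne j (-1) with rfl | h'
    · simp [binom]
    · simp [binom_of_neg h, binom_of_neg (show j + 1 < 0 by omega)]
  · lift j to ℕ using h
    have := binom_natCast (i + 1) (j + 1)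
    have h2 := binom_natCast i (j + 1)
    push_cast at this h2
    rw [this, h2, binom_natCast, Nat.choose_succ_succ]
    push_cast
    ring

theorem add_one_mul_binom (i : ℕ) (j : ℤ) : (j + 1) * binom i (j + 1) = (i - j) * binom i j := by
  rcases lt_or_ge j 0 with h | h
  · rcases eq_or_ne j (-1) with rfl | h'
    · simp [binom]
    · simp [binom_of_neg h, binom_of_neg (show j + 1 < 0 by omega)]
  · lift j to ℕ using h
    have h2 := binom_natCast i (j + 1)
    push_cast at h2
    rw [h2, binom_natCast]
    have h3 := Nat.choose_succ_right_eq i j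
    rcases le_or_gt j i with hij | hij
    · zify [hij] at h3
      linarith
    · rw [Nat.choose_eq_zero_of_lt hij, Nat.choose_eq_zero_of_lt (by omega)]
      simp

/-- The coefficient of `z ^ j` in `∑ i, i! * {n \brace i} * (-2) ^ (n - i) * (1 + z) ^ i`. -/
def stirlingCoeff (n : ℕ) (j : ℤ) : ℤ :=
  ∑ i ∈ Finset.Icc 1 n,
    (i.factorial : ℤ) * (Nat.stirlingSecond n i : ℤ) * (-2) ^ (n - i) * binom i j

theorem p_eq (n k : ℕ) :
    p n k = (-1) ^ k * (stirlingCoeff n (n - 2 * k) - stirlingCoeff n (n - 2 * k + 1)) := by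
  rw [p, stirlingCoeff, stirlingCoeff, ← Finset.sum_sub_distrib]
  simp only [mul_sub]

theorem stirlingCoeff_eq_sum_range {n : ℕ} (hn : 1 ≤ n) (j : ℤ) :
    stirlingCoeff n j = ∑ i ∈ Finset.range (n + 1),
      (i.factorial : ℤ) * (Nat.stirlingSecond n i : ℤ) * (-2) ^ (n - i) * binom i j := by
  rw [Finset.sum_range_succ', stirlingCoeff, Finset.range_eq_Ico,
    Finset.sum_Ico_add' (fun i : ℕ => (i.factorial : ℤ) * (Nat.stirlingSecond n i : ℤ) *
      (-2) ^ (n - i) * binom i j) 0 n 1]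
  obtain ⟨m, rfl⟩ : ∃ m, n = m + 1 := ⟨n - 1, by omega⟩
  simp only [Nat.stirlingSecond_succ_zero]
  simp
  rfl

/-- Coefficientwise form of F_{n+1} = (1+z) F_n + (z^2-1) F_n'. -/
theorem stirlingCoeff_succ {n : ℕ} (hn : 1 ≤ n) (j : ℤ) :
    stirlingCoeff (n + 1) (j + 1) =
      (j + 1) * stirlingCoeff n j + stirlingCoeff n (j + 1) -
        (j + 2) * stirlingCoeff n (j + 2) := by
  have hsucc : stirlingCoeff (n + 1) (j + 1) = ∑ i ∈ Finset.range (n + 1),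
      (i.factorial : ℤ) * (Nat.stirlingSecond n i : ℤ) * (-2) ^ (n - i) *
        (-2 * i * binom i (j + 1) + (i + 1) * binom (i + 1) (j + 1)) := by
    have h1 : ∀ i ∈ Finset.range (n + 1),
        ((i + 1).factorial : ℤ) * (Nat.stirlingSecond (n + 1) (i + 1) : ℤ) *
          (-2) ^ (n + 1 - (i + 1)) * binom (i + 1) (j + 1) =
        ((i + 1).factorial : ℤ) * (Nat.stirlingSecond n (i + 1) : ℤ) * (-2) ^ (n - i) *
          ((i + 1 : ℕ) * binom (i + 1) (j + 1)) +
        (i.factorial : ℤ) * (Nat.stirlingSecond n i : ℤ) * (-2) ^ (n - i) *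
          ((i + 1) * binom (i + 1) (j + 1)) := by
      intro i _
      rw [Nat.stirlingSecond_succ_succ, Nat.factorial_succ, Nat.add_sub_add_right]
      push_cast
      ring
    have h2 : ∑ i ∈ Finset.range (n + 1),
        ((i + 1).factorial : ℤ) * (Nat.stirlingSecond n (i + 1) : ℤ) * (-2) ^ (n - i) *
          ((i + 1 : ℕ) * binom (i + 1) (j + 1)) =
        ∑ i ∈ Finset.range (n + 1),
          (i.factorial : ℤ) * (Nat.stirlingSecond n i : ℤ) * (-2) ^ (n - i) *
            (-2 * i * binom i (j + 1)) := by
      -- Index shift: the last term on the left has a vanishing Stirling number, the term `i = 0` on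
      -- the right has the factor `i`, and the shift costs one factor -2.
      rw [Finset.sum_range_succ, Nat.stirlingSecond_eq_zero_of_lt (Nat.lt_succ_self n),
        Finset.sum_range_succ' _ n]
      simp only [Nat.cast_zero, mul_zero, zero_mul, add_zero]
      refine Finset.sum_congr rfl fun i hi => ?_
      rw [Finset.mem_range] at hi
      rw [show n - i = n - (i + 1) + 1 by omega, pow_succ]
      ring
    rw [stirlingCoeff_eq_sum_range (by omega), Finset.sum_range_succ', Finset.sum_congr rfl h1,
      Finset.sum_add_distrib, h2, ← Finset.sum_add_distrib, Nat.stirlingSecond_succ_zero]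
    simp only [Nat.cast_zero, mul_zero, zero_mul, add_zero]
    exact Finset.sum_congr rfl fun i _ => by ring
  rw [hsucc, stirlingCoeff_eq_sum_range hn, stirlingCoeff_eq_sum_range hn,
    stirlingCoeff_eq_sum_range hn, Finset.mul_sum, Finset.mul_sum, ← Finset.sum_add_distrib,
    ← Finset.sum_sub_distrib]
  refine Finset.sum_congr rfl fun i _ => ?_
  have h1 := binom_succ i j
  have h2 := add_one_mul_binom i j
  have h3 := add_one_mul_binom i (j + 1)
  rw [show j + 1 + 1 = j + 2 by ring] at h3
  have h4 : -2 * (i : ℤ) * binom i (j + 1) + (i + 1) * binom (i + 1) (j + 1) =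
      (j + 1) * binom i j + binom i (j + 1) - (j + 2) * binom i (j + 2) := by
    rw [h1]
    linear_combination h3 - h2
  rw [h4]
  ring

/-- The differences are the coefficients of G_n = (z-1) F_n, and the relation is G_{n+1} = (z^2-1)
G_n'. -/
theorem stirlingCoeff_sub_succ {n : ℕ} (hn : 1 ≤ n) (j : ℤ) :
    stirlingCoeff (n + 1) (j - 1) - stirlingCoeff (n + 1) j =
      (j - 1) * (stirlingCoeff n (j - 2) - stirlingCoeff n (j - 1)) -
        (j + 1) * (stirlingCoeff n j - stirlingCoeff n (j + 1)) := by
  have h1 := stirlingCoeff_succ hn (j - 2)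
  have h2 := stirlingCoeff_succ hn (j - 1)
  rw [show j - 2 + 1 = j - 1 by ring, sub_add_cancel] at h1
  rw [sub_add_cancel, show j - 1 + 2 = j + 1 by ring] at h2
  linear_combination h1 - h2

theorem p_succ_succ {n : ℕ} (hn : 1 ≤ n) (k : ℕ) :
    p (n + 1) (k + 1) = (n - 1 - 2 * k) * p n (k + 1) + (n + 1 - 2 * k) * p n k := by
  have := stirlingCoeff_sub_succ hn (n - 2 * k)
  rw [p_eq, p_eq, p_eq]
  push_cast
  rw [show (n : ℤ) + 1 - 2 * (k + 1) = n - 2 * k - 1 by ring, sub_add_cancel, this,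
    show (n : ℤ) - 2 * (k + 1) = n - 2 * k - 2 by ring,
    show (n : ℤ) - 2 * k - 2 + 1 = n - 2 * k - 1 by ring]
  ring

theorem p_succ_zero {n : ℕ} (hn : 1 ≤ n) : p (n + 1) 0 = (n + 1) * p n 0 := by
  have := stirlingCoeff_sub_succ hn (n + 2)
  have h0 : ∀ j : ℤ, n < j → stirlingCoeff n j = 0 := by
    intro j hj
    refine Finset.sum_eq_zero fun i hi => ?_
    lift j to ℕ using by omega
    rw [binom_natCast, Nat.choose_eq_zero_of_lt (by have := Finset.mem_Icc.1 hi; omega)]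
    simp
  rw [p_eq, p_eq]
  push_cast
  simp only [sub_zero, one_mul]
  rw [h0 (n + 2) (by omega), h0 (n + 2 + 1) (by omega)] at this
  rw [show (n : ℤ) + 2 - 1 = n + 1 by ring, add_sub_cancel_right] at this
  rw [show (n : ℤ) + 1 + 1 = n + 2 by ring, this]
  ring

theorem p_eq_zero {n k : ℕ} (h : n + 1 < 2 * k) : p n k = 0 := by
  rw [p, mul_eq_zero]
  refine Or.inr (Finset.sum_eq_zero fun i _ => ?_)
  rw [binom_of_neg (by omega), binom_of_neg (by omega)]
  simp

/-! ### Generating polynomials and the substitution y = 2x - 1 -/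

open Polynomial

theorem coeff_SPoly (n k : ℕ) : (SPoly n).coeff k = S n k := by
  simp only [SPoly, finsetSum_coeff, coeff_C_mul, coeff_X_pow, mul_ite, mul_one, mul_zero,
    Finset.sum_ite_eq, Finset.mem_range]
  split_ifs with h
  · rfl
  · rw [S_eq_zero (by omega), Nat.cast_zero]

theorem SPoly_zero : SPoly 0 = 1 := by
  ext k
  rw [coeff_SPoly, S_zero_left, coeff_one]
  split_ifs <;> rfl

theorem SPoly_succ (n : ℕ) :
    SPoly (n + 1) = (1 + (n : ℤ[X]) * X) * SPoly n + X * (1 - 2 * X) * derivative (SPoly n) := by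
  have e : (1 + (n : ℤ[X]) * X) * SPoly n + X * (1 - 2 * X) * derivative (SPoly n) =
      SPoly n + X * (C (n : ℤ) * SPoly n + derivative (SPoly n) -
        C 2 * (X * derivative (SPoly n))) := by
    simp only [map_natCast, map_ofNat]
    ring
  rw [e]
  ext k
  rcases k with _ | k
  · simp [coeff_SPoly, S_succ_zero]
  · rw [coeff_add, coeff_X_mul, coeff_sub, coeff_add, coeff_C_mul, coeff_C_mul, coeff_derivative,
      coeff_SPoly, coeff_SPoly, coeff_SPoly, S_succ_succ]
    have hX : (X * derivative (SPoly n)).coeff k = (k : ℤ) * (S n k : ℤ) := by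
      rcases k with _ | k
      · simp
      · rw [coeff_X_mul, coeff_derivative, coeff_SPoly]
        push_cast
        ring
    rw [hX]
    -- The recursion contains a truncated `n - 2 * k`; where truncation bites, `S n k` is zero.
    rcases le_or_gt (2 * k) n with hk | hk
    · push_cast [hk]
      ring
    · rw [S_eq_zero (show n / 2 < k by omega)]
      push_cast
      ring

/-- The polynomial `∑ k, p(n, n - 2k + 1) y ^ k`. -/
noncomputable def pPoly (n : ℕ) : ℤ[X] :=
  ∑ k ∈ Finset.range ((n + 1) / 2 + 1), C (p n k) * X ^ k

theorem coeff_pPoly (n k : ℕ) : (pPoly n).coeff k = p n k := by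
  simp only [pPoly, finsetSum_coeff, coeff_C_mul, coeff_X_pow, mul_ite, mul_one, mul_zero,
    Finset.sum_ite_eq, Finset.mem_range]
  split_ifs with h
  · rfl
  · rw [p_eq_zero (by omega)]

theorem pPoly_one : pPoly 1 = 1 + X := by
  have h0 : p 1 0 = 1 := by decide
  have h1 : p 1 1 = 1 := by decide
  simp [pPoly, Finset.sum_range_succ, h0, h1]

theorem pPoly_succ {n : ℕ} (hn : 1 ≤ n) :
    pPoly (n + 1) = (1 + X) * (((n : ℤ[X]) + 1) * pPoly n - 2 * X * derivative (pPoly n)) := by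
  have e : (1 + X) * (((n : ℤ[X]) + 1) * pPoly n - 2 * X * derivative (pPoly n)) =
      (C (n + 1 : ℤ) * pPoly n - C 2 * (X * derivative (pPoly n))) +
        X * (C (n + 1 : ℤ) * pPoly n - C 2 * (X * derivative (pPoly n))) := by
    simp only [map_natCast, map_ofNat, map_add, map_one]
    ring
  have hX : ∀ k, (X * derivative (pPoly n)).coeff k = k * p n k := by
    rintro (_ | k)
    · simp
    · rw [coeff_X_mul, coeff_derivative, coeff_pPoly]
      push_cast
      ring
  rw [e]
  ext k
  rcases k with _ | k
  · simp [coeff_pPoly, p_succ_zero hn]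
  · rw [coeff_add, coeff_X_mul, coeff_sub, coeff_sub, coeff_C_mul, coeff_C_mul, coeff_C_mul,
      coeff_C_mul, hX, hX, coeff_pPoly, coeff_pPoly, coeff_pPoly, p_succ_succ hn]
    push_cast
    ring

/-- At y = 2x - 1 one has 1 + y = 2x, and both sides satisfy the same recursion and agree for n = 0.
-/
theorem two_pow_mul_X_mul_SPoly (n : ℕ) :
    2 ^ (n + 1) * X * SPoly n = (pPoly (n + 1)).comp (2 * X - 1) := by
  induction n with
  | zero =>
    rw [SPoly_zero, zero_add, pPoly_one, add_comp, X_comp, one_comp]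
    ring
  | succ n ih =>
    -- Differentiating the induction hypothesis expresses the derivative of `pPoly`, evaluated at 2x
    -- - 1, through `SPoly n` and its derivative.
    have hd : derivative (2 ^ (n + 1) * X * SPoly n) =
        2 * (derivative (pPoly (n + 1))).comp (2 * X - 1) := by
      rw [ih, derivative_comp]
      simp [derivative_mul]
    have hd' : derivative (2 ^ (n + 1) * X * SPoly n) =
        2 ^ (n + 1) * (SPoly n + X * derivative (SPoly n)) := by
      rw [mul_assoc, show (2 : ℤ[X]) ^ (n + 1) = C (2 ^ (n + 1)) by simp, derivative_C_mul,
        derivative_mul, derivative_X, one_mul]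
    rw [hd'] at hd
    rw [pPoly_succ (by omega), SPoly_succ]
    simp only [mul_comp, add_comp, sub_comp, one_comp, X_comp, natCast_comp, ofNat_comp, ← ih]
    push_cast
    linear_combination (-2 * X * (2 * X - 1)) * hd

theorem aeval_SPoly (n : ℕ) {x : ℂ} (hx : x ≠ 0) :
    aeval x (SPoly n) = 1 / (2 ^ (n + 1) * x) *
      ∑ k ∈ Finset.range (n / 2 + 1 + 1), (p (n + 1) k : ℂ) * (2 * x - 1) ^ k := by
  have h := congrArg (aeval x) (two_pow_mul_X_mul_SPoly n)
  rw [aeval_comp, pPoly, show (n + 1 + 1) / 2 = n / 2 + 1 by omega] at h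
  simp only [map_mul, map_pow, map_sub, map_sum, map_one, map_ofNat, aeval_X,
    eq_intCast, map_intCast] at h
  rw [← h]
  field_simp

end Simsun

theorem mainTheorem1 (n : ℕ) (hn : 1 ≤ n) :
    (∀ k : ℕ, k ≤ n / 2 → Simsun.W (n + 1) k = 2 ^ (n - k) * Simsun.S n k) ∧
    (∀ x : ℂ, x ≠ 0 →
      Polynomial.aeval x (Simsun.SPoly n) =
        1 / (2 ^ (n + 1) * x) *
          ∑ k ∈ Finset.range (n / 2 + 1 + 1), (Simsun.p (n + 1) k : ℂ) * (2 * x - 1) ^ k) ∧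
    (∀ k : ℕ, k ≤ n / 2 →
      (∀ π ∈ Simsun.simsunPerms n k,
        Simsun.Phi π ⊆ (Simsun.peakPerms (n + 1) k : Set (Equiv.Perm (Fin (n + 1)))) ∧
        (Simsun.Phi π).ncard = 2 ^ (n - k)) ∧
      (∀ σ ∈ Simsun.peakPerms (n + 1) k,
        ∃! π : Equiv.Perm (Fin n), π ∈ Simsun.simsunPerms n k ∧ σ ∈ Simsun.Phi π)) := by
  refine ⟨fun k _ => Simsun.W_succ hn k, fun x hx => Simsun.aeval_SPoly n hx, fun k _ =>
    ⟨fun π hπ => ⟨Simsun.Phi_subset hn hπ, ?_⟩, fun σ hσ => Simsun.existsUnique_mem_Phi hn hσ⟩⟩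
  obtain ⟨hs, rfl⟩ := Simsun.mem_simsunPerms.1 hπ
  exact Simsun.ncard_Phi hn hs
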